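/- For $\tau\in\mathbb{C}$ with $\operatorname{Im}\tau>0$ put $q^{r}=\exp(2\pi i r\tau)$ for real $r$, let $$\eta(\tau)=q^{1/24}\prod_{n=1}^\infty(1-q^n)$$ be the Dedekind eta function, and let $$\vartheta_2(\tau)=2\sum_{n=0}^\infty q^{(2n+1)^2/8},\qquad \vartheta_3(\tau)=1+2\sum_{n=1}^\infty q^{n^2/2},\qquad \vartheta_4(\tau)=1+2\sum_{n=1}^\infty(-1)^n q^{n^2/2}$$ be the Jacobi theta constants, i.e. the values at $z=0$ of $$\theta_2(z|\tau)=2\sum_{n=0}^\infty q^{(2n+1)^2/8}\cos((2n+1)z),\quad \theta_3(z|\tau)=1+2\sum_{n=1}^\infty q^{n^2/2}\cos(2nz),\quad \theta_4(z|\tau)=1+2\sum_{n=1}^\infty(-1)^n q^{n^2/2}\cos(2nz).$$ Then for every $\tau$ with $\operatorname{Im}\tau>0$ the numbers $\vartheta_2(\tau),\vartheta_3(\tau),\vartheta_4(\tau),\eta(\tau)$ are nonzero, and $$\frac{\vartheta_2(21\tau)}{\vartheta_2(\tau)}-\frac{\vartheta_3(21\tau)}{\vartheta_3(\tau)}+\frac{\vartheta_4(21\tau)}{\vartheta_4(\tau)}=\frac{4\,\eta^3(3\tau)\,\eta(7\tau)}{\eta^4(\tau)}-7\,\frac{\eta^3(21\tau)}{\eta^3(\tau)}.$$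 -/

import Mathlib

noncomputable section

/-- The power `q ^ r` of the nome `q = exp (2 π i τ)`, for a real exponent `r`, read as
`exp (2 π i r τ)` (no choice of a branch is involved). -/
def nomePow (τ : ℂ) (r : ℝ) : ℂ :=
  Complex.exp (2 * (Real.pi : ℂ) * Complex.I * (r : ℂ) * τ)

/-- `θ₂(z|τ) = 2 ∑_{n ≥ 0} q^{(2n+1)²/8} cos((2n+1)z)`. -/
def theta2 (z τ : ℂ) : ℂ :=
  2 * ∑' n : ℕ, nomePow τ ((2 * (n : ℝ) + 1) ^ 2 / 8) * Complex.cos ((2 * (n : ℂ) + 1) * z)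

/-- `θ₃(z|τ) = 1 + 2 ∑_{n ≥ 1} q^{n²/2} cos(2nz)`; the summation index is shifted by one. -/
def theta3 (z τ : ℂ) : ℂ :=
  1 + 2 * ∑' n : ℕ, nomePow τ (((n : ℝ) + 1) ^ 2 / 2) * Complex.cos (2 * ((n : ℂ) + 1) * z)

/-- `θ₄(z|τ) = 1 + 2 ∑_{n ≥ 1} (-1)^n q^{n²/2} cos(2nz)`; the summation index is shifted by
one. -/
def theta4 (z τ : ℂ) : ℂ :=
  1 + 2 * ∑' n : ℕ, (-1) ^ (n + 1) * nomePow τ (((n : ℝ) + 1) ^ 2 / 2) *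
    Complex.cos (2 * ((n : ℂ) + 1) * z)

/-- The theta constant `ϑ₂(τ) = θ₂(0|τ)`. -/
def vartheta2 (τ : ℂ) : ℂ := theta2 0 τ

/-- The theta constant `ϑ₃(τ) = θ₃(0|τ)`. -/
def vartheta3 (τ : ℂ) : ℂ := theta3 0 τ

/-- The theta constant `ϑ₄(τ) = θ₄(0|τ)`. -/
def vartheta4 (τ : ℂ) : ℂ := theta4 0 τ

end

/-!
The identity is the vanishing of the sum of the residues of an elliptic function. Put
`Θ(x; q) = (x; q)_∞ (q / x; q)_∞`, which satisfies `Θ(q x; q) = -x⁻¹ Θ(x; q)` and has simple zeros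
exactly at the integral powers of `q`. The function
`w⁻² Θ(w⁷; q²¹) / (Θ(w; q) Θ(w²; q³))` is invariant under `w ↦ q³ w`
(`quotientForm_mul`). Modulo `q³` its poles are simple and lie at `w = 1`, at the square roots
`-1, ±h³` of `1` and `q³`, where `h² = q`, and at `w = q, q²`. At `-1, h³, -h³` the residues are
multiples of the quotients of `ϑ₂`, `ϑ₄`, `ϑ₃` at `21τ` and `τ`. At `1` the double zero of the
denominator meets a zero of the numerator, and the residue is a multiple of `η(21τ)³ / η(τ)³`. At
`q` and `q²` the products `Θ(q⁷; q²¹)` and `Θ(q; q³)` collapse to quotients of Euler products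
(`thetaProd_cube`), and each residue is the same multiple of `η(3τ)³ η(7τ) / η(τ)⁴`.

The residues add up to zero (`sum_residues_quotientForm`) because the invariant form
`f(w) dw / w` has equal integrals over the two circles bounding a fundamental annulus
(`circleIntegral_norm_mul_eq`), while their difference is the sum of the residues
(`circleIntegral_sub_circleIntegral_eq_sum_residues`).

The theta constants are turned into products by the Jacobi triple product
(`tsum_eq_eulerProd_mul_thetaProd`), obtained from Rothe's `q`-binomial theorem by letting the
number of factors tend to infinity. The product form also shows that they do not vanish.
-/

/-! ### Infinite `q`-products -/

/-- The `q`-Pochhammer symbol `(x; q)_∞ = ∏_{n ≥ 0} (1 - x qⁿ)`. -/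
noncomputable def qPoch (x q : ℂ) : ℂ := ∏' n : ℕ, (1 - x * q ^ n)

/-- Euler's product `(q; q)_∞ = ∏_{n ≥ 1} (1 - qⁿ)`. -/
noncomputable def eulerProd (q : ℂ) : ℂ := qPoch q q

/-- The theta function in multiplicative form, without its constant factor:
`(x; q)_∞ (q / x; q)_∞`. -/
noncomputable def thetaProd (x q : ℂ) : ℂ := qPoch x q * qPoch (q / x) q

section Products

open Filter Topology Finset

lemma summable_norm_mul_pow (x : ℂ) {q : ℂ} (hq : ‖q‖ < 1) :
    Summable fun n : ℕ ↦ ‖-(x * q ^ n)‖ := by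
  simpa using (summable_geometric_of_lt_one (norm_nonneg q) hq).mul_left ‖x‖

lemma multipliable_qPoch (x : ℂ) {q : ℂ} (hq : ‖q‖ < 1) :
    Multipliable fun n : ℕ ↦ 1 - x * q ^ n := by
  simpa [sub_eq_add_neg] using! multipliable_one_add_of_summable (summable_norm_mul_pow x hq)

lemma tendsto_prod_qPoch (x : ℂ) {q : ℂ} (hq : ‖q‖ < 1) :
    Tendsto (fun N ↦ ∏ n ∈ range N, (1 - x * q ^ n)) atTop (𝓝 (qPoch x q)) :=
  (multipliable_qPoch x hq).hasProd.tendsto_prod_nat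

lemma qPoch_ne_zero {x q : ℂ} (hq : ‖q‖ < 1) (h : ∀ n : ℕ, x * q ^ n ≠ 1) : qPoch x q ≠ 0 := by
  have := tprod_one_add_ne_zero_of_summable (f := fun n : ℕ ↦ -(x * q ^ n))
    (fun n ↦ by rw [← sub_eq_add_neg]; exact sub_ne_zero.2 (h n).symm) (summable_norm_mul_pow x hq)
  simpa [sub_eq_add_neg, qPoch] using this

lemma qPoch_ne_zero_of_norm_lt {x q : ℂ} (hq : ‖q‖ < 1) (hx : ‖x‖ < 1) : qPoch x q ≠ 0 := by
  refine qPoch_ne_zero hq fun n h ↦ ?_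
  have h1 : ‖x‖ * ‖q‖ ^ n = 1 := by simpa using congrArg norm h
  have h2 : ‖q‖ ^ n ≤ 1 := pow_le_one₀ (norm_nonneg _) hq.le
  nlinarith [norm_nonneg x, pow_nonneg (norm_nonneg q) n]

lemma eulerProd_ne_zero {q : ℂ} (hq : ‖q‖ < 1) : eulerProd q ≠ 0 :=
  qPoch_ne_zero_of_norm_lt hq hq

lemma qPoch_eq_mul (x : ℂ) {q : ℂ} (hq : ‖q‖ < 1) :
    qPoch x q = (1 - x) * qPoch (q * x) q := by
  refine tendsto_nhds_unique ((tendsto_add_atTop_iff_nat 1).2 (tendsto_prod_qPoch x hq))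
    (((tendsto_prod_qPoch (q * x) hq).const_mul (1 - x)).congr fun N ↦ ?_)
  rw [prod_range_succ']
  simp only [pow_zero, mul_one, pow_succ]
  rw [mul_comm]
  congr 1
  exact prod_congr rfl fun n _ ↦ by ring

lemma differentiable_qPoch {q : ℂ} (hq : ‖q‖ < 1) : Differentiable ℂ fun x ↦ qPoch x q := by
  have key : ∀ R : ℝ, DifferentiableOn ℂ (fun x ↦ qPoch x q) (Metric.ball 0 R) := by
    intro R
    have hu : Summable fun n : ℕ ↦ R * ‖q‖ ^ n :=
      (summable_geometric_of_lt_one (norm_nonneg q) hq).mul_left R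
    have H := hu.hasProdLocallyUniformlyOn_nat_one_add (K := Metric.ball (0 : ℂ) R)
      (f := fun n x ↦ -(x * q ^ n)) Metric.isOpen_ball
      (.of_forall fun n x hx ↦ by
        have : ‖x‖ ≤ R := by simpa using (Metric.mem_ball.1 hx).le
        simpa using mul_le_mul_of_nonneg_right this (pow_nonneg (norm_nonneg q) n))
      (fun n ↦ by fun_prop)
    have := H.differentiableOn (.of_forall fun s ↦ by
      simpa [Finset.prod_fn] using DifferentiableOn.fun_finsetProd (fun _ _ ↦ by fun_prop))
      Metric.isOpen_ball
    simpa [qPoch, sub_eq_add_neg] using this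
  intro x
  exact (key (‖x‖ + 1)).differentiableAt (Metric.isOpen_ball.mem_nhds (by simp))

/-- Sorting the factors of `(x; q)_∞` by the residue of the exponent modulo `3`. -/
lemma qPoch_eq_mul_mul_cube (x : ℂ) {q : ℂ} (hq : ‖q‖ < 1) :
    qPoch x q = qPoch x (q ^ 3) * qPoch (q * x) (q ^ 3) * qPoch (q ^ 2 * x) (q ^ 3) := by
  have hq3 : ‖q ^ 3‖ < 1 := by simpa using pow_lt_one₀ (norm_nonneg q) hq three_ne_zero
  have h3 : Tendsto (fun N : ℕ ↦ 3 * N) atTop atTop := tendsto_id.const_mul_atTop' (by norm_num)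
  refine tendsto_nhds_unique ((tendsto_prod_qPoch x hq).comp h3)
    ((((tendsto_prod_qPoch x hq3).mul (tendsto_prod_qPoch (q * x) hq3)).mul
      (tendsto_prod_qPoch (q ^ 2 * x) hq3)).congr fun N ↦ ?_)
  simp only [Function.comp]
  induction N with
  | zero => simp
  | succ N ih =>
    rw [show 3 * (N + 1) = 3 * N + 1 + 1 + 1 by ring]
    simp only [prod_range_succ] at ih ⊢
    rw [← ih]
    ring

lemma thetaProd_eq_mul {x q : ℂ} (hq : ‖q‖ < 1) :
    thetaProd x q = (1 - x) * (qPoch (q * x) q * qPoch (q / x) q) := by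
  rw [thetaProd, qPoch_eq_mul x hq, mul_assoc]

lemma thetaProd_mul_left {x q : ℂ} (hq : ‖q‖ < 1) (hq0 : q ≠ 0) (hx : x ≠ 0) :
    thetaProd (q * x) q = -x⁻¹ * thetaProd x q := by
  rw [thetaProd_eq_mul (x := x) hq, thetaProd, show q / (q * x) = x⁻¹ by field_simp,
    qPoch_eq_mul x⁻¹ hq, ← div_eq_mul_inv]
  field_simp
  ring

lemma thetaProd_div (x : ℂ) {q : ℂ} (hq0 : q ≠ 0) : thetaProd (q / x) q = thetaProd x q := by
  rw [thetaProd, thetaProd, div_div_cancel₀ hq0, mul_comm]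

lemma thetaProd_ne_zero {x q : ℂ} (hq : ‖q‖ < 1) (hx : x ≠ 0) (h : ∀ n : ℤ, x ≠ q ^ n) :
    thetaProd x q ≠ 0 := by
  refine mul_ne_zero (qPoch_ne_zero hq fun n hn ↦ h (-n) ?_)
    (qPoch_ne_zero hq fun n hn ↦ h (n + 1) ?_)
  · rw [zpow_neg, zpow_natCast]
    exact eq_inv_of_mul_eq_one_left hn
  · rw [div_mul_eq_mul_div, div_eq_one_iff_eq hx] at hn
    rw [← hn]
    exact_mod_cast (pow_succ' q n).symm

lemma differentiableAt_thetaProd {x q : ℂ} (hq : ‖q‖ < 1) (hx : x ≠ 0) :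
    DifferentiableAt ℂ (fun x ↦ thetaProd x q) x := by
  have h1 := differentiable_qPoch hq x
  have h2 : DifferentiableAt ℂ (fun x ↦ qPoch (q / x) q) x :=
    (differentiable_qPoch hq (q / x)).comp x (by fun_prop (disch := assumption))
  exact h1.mul h2

lemma thetaProd_one {q : ℂ} (hq : ‖q‖ < 1) : thetaProd 1 q = 0 := by
  rw [thetaProd_eq_mul hq, sub_self, zero_mul]

lemma hasDerivAt_thetaProd_one {q : ℂ} (hq : ‖q‖ < 1) :
    HasDerivAt (fun x ↦ thetaProd x q) (-eulerProd q ^ 2) 1 := by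
  have hd : DifferentiableAt ℂ (fun x ↦ qPoch (q * x) q * qPoch (q / x) q) 1 := by
    have h := differentiable_qPoch hq
    exact ((h (q * 1)).comp (1 : ℂ) (by fun_prop)).mul
      ((h (q / 1)).comp (1 : ℂ) (by fun_prop (disch := norm_num)))
  have h := ((hasDerivAt_id (1 : ℂ)).const_sub 1).mul hd.hasDerivAt
  refine (h.congr_deriv ?_).congr_of_eventuallyEq (.of_forall fun x ↦ thetaProd_eq_mul hq)
  simp [eulerProd, sq]

/-- The functional equation carries a zero of the theta product at `y` to one at `q y`. -/
lemma hasDerivAt_thetaProd_mul_left {q y d : ℂ} (hq : ‖q‖ < 1) (hq0 : q ≠ 0) (hy : y ≠ 0)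
    (h0 : thetaProd y q = 0) (h : HasDerivAt (fun x ↦ thetaProd x q) d y) :
    HasDerivAt (fun x ↦ thetaProd x q) (-y⁻¹ * d / q) (q * y) := by
  have hyq : q * y / q = y := by field_simp
  have h1 : HasDerivAt (fun x ↦ x / q) (1 / q) (q * y) := (hasDerivAt_id _).div_const q
  have h2 : HasDerivAt (fun x ↦ thetaProd (x / q) q) (d * (1 / q)) (q * y) :=
    HasDerivAt.comp (h₂ := fun x ↦ thetaProd x q) (q * y) (by rwa [hyq]) h1
  have h3 : HasDerivAt (fun x ↦ -(x / q)⁻¹) (-(-(1 / q) / (q * y / q) ^ 2)) (q * y) :=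
    (h1.fun_inv (by rwa [hyq])).neg
  refine ((h3.mul h2).congr_deriv ?_).congr_of_eventuallyEq ?_
  · rw [hyq, h0]
    ring
  · filter_upwards [isOpen_ne.mem_nhds (mul_ne_zero hq0 hy)] with x hx
    have := thetaProd_mul_left hq hq0 (div_ne_zero hx hq0)
    rwa [mul_div_cancel₀ x hq0] at this

/-- The left side collects the factors `1 - qⁿ` with `n` not divisible by `3`. -/
lemma thetaProd_cube {q : ℂ} (hq : ‖q‖ < 1) (hq0 : q ≠ 0) :
    thetaProd q (q ^ 3) = eulerProd q / eulerProd (q ^ 3) := by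
  have hq3 : ‖q ^ 3‖ < 1 := by simpa using pow_lt_one₀ (norm_nonneg q) hq three_ne_zero
  rw [eq_div_iff (eulerProd_ne_zero hq3), eulerProd, eulerProd, qPoch_eq_mul_mul_cube q hq,
    thetaProd, show q ^ 3 / q = q * q by field_simp, show q ^ 2 * q = q ^ 3 by ring]

end Products

/-! ### Residues in an annulus -/

section Residues

open Filter Topology Metric Set Function

lemma circleIntegral_sub_inv_eq_zero {a : ℂ} {r : ℝ} (hr : 0 ≤ r) (ha : r < ‖a‖) :
    (∮ z in C(0, r), (z - a)⁻¹) = 0 := by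
  refine Complex.circleIntegral_eq_zero_of_differentiable_on_off_countable hr countable_empty
    ?_ ?_
  · intro z hz
    have : z - a ≠ 0 := sub_ne_zero.2 (by rintro rfl; simp at hz; linarith)
    exact ContinuousAt.continuousWithinAt (by fun_prop (disch := assumption))
  · intro z hz
    have : z - a ≠ 0 := sub_ne_zero.2 (by rintro rfl; simp at hz; linarith)
    fun_prop (disch := assumption)

/-- The residue theorem for an annulus and a function with simple poles, whose residues are given
as limits. The poles are removed one at a time. -/
lemma circleIntegral_sub_circleIntegral_eq_sum_residues {r R : ℝ} (hr : 0 < r) (hrR : r ≤ R)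
    (S : Finset ℂ) (hS : ∀ a ∈ S, r < ‖a‖ ∧ ‖a‖ < R) (res : ℂ → ℂ) (f : ℂ → ℂ)
    (hd : ∀ z, r ≤ ‖z‖ → ‖z‖ ≤ R → z ∉ S → DifferentiableAt ℂ f z)
    (hres : ∀ a ∈ S, Tendsto (fun z ↦ (z - a) * f z) (𝓝[≠] a) (𝓝 (res a))) :
    (∮ z in C(0, R), f z) - (∮ z in C(0, r), f z) =
      2 * Real.pi * Complex.I * ∑ a ∈ S, res a := by
  classical
  induction S using Finset.induction_on generalizing f with
  | empty =>
    simp only [Finset.sum_empty, mul_zero, sub_eq_zero]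
    refine Complex.circleIntegral_eq_of_differentiable_on_annulus_off_countable hr hrR
      countable_empty ?_ ?_
    · intro z hz
      simp only [Set.mem_sdiff, mem_closedBall, dist_zero_right, mem_ball, not_lt] at hz
      exact (hd z hz.2 hz.1 (by simp)).continuousAt.continuousWithinAt
    · intro z hz
      simp only [Set.mem_sdiff, mem_closedBall, dist_zero_right, mem_ball, not_le] at hz
      exact hd z hz.1.2.le hz.1.1.le (by simp)
  | insert a S ha ih =>
    obtain ⟨har, haR⟩ := hS a (by simp)
    set c := res a with hc
    set g : ℂ → ℂ := fun z ↦ f z - c * (z - a)⁻¹ with hg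
    set g' : ℂ → ℂ := update g a (limUnder (𝓝[≠] a) g) with hg'
    have hgd : ∀ z, r ≤ ‖z‖ → ‖z‖ ≤ R → z ∉ S → z ≠ a → DifferentiableAt ℂ g z := by
      intro z h1 h2 h3 h4
      have : z - a ≠ 0 := sub_ne_zero.2 h4
      have := hd z h1 h2 (by simp [h3, h4])
      fun_prop (disch := assumption)
    have hg'eq : ∀ z, z ≠ a → g' =ᶠ[𝓝 z] g := fun z hz ↦ by
      filter_upwards [isOpen_ne.mem_nhds hz] with w hw
      exact update_of_ne hw _ _
    have hga : DifferentiableAt ℂ g' a := by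
      set s : Set ℂ := {z | r < ‖z‖} ∩ {z | ‖z‖ < R} ∩ (S : Set ℂ)ᶜ
      have hs : s ∈ 𝓝 a := by
        refine IsOpen.mem_nhds ?_ ⟨⟨har, haR⟩, by simpa using ha⟩
        exact ((isOpen_lt continuous_const continuous_norm).inter
          (isOpen_lt continuous_norm continuous_const)).inter S.finite_toSet.isClosed.isOpen_compl
      refine (Complex.differentiableOn_update_limUnder_of_isLittleO hs ?_ ?_).differentiableAt hs
      · rintro z ⟨⟨⟨h1, h2⟩, h3⟩, h4⟩
        exact (hgd z (le_of_lt h1) (le_of_lt h2) h3 h4).differentiableWithinAt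
      · have h0 : Tendsto (fun z : ℂ ↦ z - a) (𝓝[≠] a) (𝓝 0) := by
          have : ContinuousAt (fun z : ℂ ↦ z - a) a := by fun_prop
          simpa using this.tendsto.mono_left (nhdsWithin_le_nhds (s := {a}ᶜ))
        refine (Asymptotics.isLittleO_iff_tendsto' ?_).2 ?_
        · filter_upwards [self_mem_nhdsWithin] with z hz h
          exact absurd (inv_eq_zero.1 h) (sub_ne_zero.2 hz)
        · have h1 := ((hres a (by simp)).sub_const c).sub (h0.mul_const (g a))
          rw [← hc, sub_self, zero_mul, sub_zero] at h1
          refine h1.congr' ?_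
          filter_upwards [self_mem_nhdsWithin] with z hz
          have : z - a ≠ 0 := sub_ne_zero.2 hz
          simp only [hg]
          field_simp
    have key := ih (fun b hb ↦ hS b (by simp [hb])) g' (fun z h1 h2 h3 ↦ by
        rcases eq_or_ne z a with rfl | h4
        · exact hga
        · exact (hgd z h1 h2 h3 h4).congr_of_eventuallyEq (hg'eq z h4)) (fun b hb ↦ by
        have hba : b ≠ a := by rintro rfl; exact ha hb
        have h0 : Tendsto (fun z : ℂ ↦ (z - b) * (c * (z - a)⁻¹)) (𝓝[≠] b) (𝓝 0) := by
          have : b - a ≠ 0 := sub_ne_zero.2 hba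
          have : ContinuousAt (fun z : ℂ ↦ (z - b) * (c * (z - a)⁻¹)) b := by
            fun_prop (disch := assumption)
          simpa using this.tendsto.mono_left (nhdsWithin_le_nhds (s := {b}ᶜ))
        have h1 := (hres b (by simp [hb])).sub h0
        rw [sub_zero] at h1
        refine h1.congr' ?_
        filter_upwards [(hg'eq b hba).filter_mono nhdsWithin_le_nhds] with z hz
        rw [hz]
        ring)
    have hint : ∀ ρ : ℝ, r ≤ ρ → ρ ≤ R → (∀ b ∈ insert a S, ρ ≠ ‖b‖) →
        (∮ z in C(0, ρ), g' z) = (∮ z in C(0, ρ), f z) - c * ∮ z in C(0, ρ), (z - a)⁻¹ := by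
      intro ρ h1 h2 h3
      have hρ : 0 ≤ ρ := hr.le.trans h1
      have hne : ∀ z ∈ sphere (0 : ℂ) ρ, z ∉ insert a S := fun z hz hzS ↦
        h3 z hzS (by simpa using hz.symm)
      have hfc : CircleIntegrable f 0 ρ := ContinuousOn.circleIntegrable hρ fun z hz ↦ by
        have hz' : ‖z‖ = ρ := by simpa using hz
        exact (hd z (by linarith) (by linarith) (hne z hz)).continuousAt.continuousWithinAt
      have hic : CircleIntegrable (fun z ↦ c * (z - a)⁻¹) 0 ρ :=
        ContinuousOn.circleIntegrable hρ fun z hz ↦ by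
          have : z - a ≠ 0 := sub_ne_zero.2 fun h ↦ hne z hz (by simp [h])
          exact ContinuousAt.continuousWithinAt (by fun_prop (disch := assumption))
      rw [← circleIntegral.integral_const_mul, ← circleIntegral.integral_sub hfc hic]
      refine circleIntegral.integral_congr hρ fun z hz ↦ ?_
      exact update_of_ne (fun h ↦ hne z hz (by simp [h])) _ _
    rw [hint R hrR le_rfl (fun b hb ↦ (hS b hb).2.ne'), hint r le_rfl hrR
      (fun b hb ↦ (hS b hb).1.ne), circleIntegral_sub_inv_eq_zero hr.le har,
      circleIntegral.integral_sub_inv_of_mem_ball (by simpa using haR)] at key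
    rw [Finset.sum_insert ha, mul_add, ← key]
    ring

/-- The differential form `f(z) dz` has equal integrals over two circles that a multiplication
`z ↦ p z` carries into each other. -/
lemma circleIntegral_norm_mul_eq (p : ℂ) {R : ℝ} (f : ℂ → ℂ)
    (hf : ∀ z, ‖z‖ = |R| → p * f (p * z) = f z) :
    (∮ z in C(0, ‖p‖ * R), f z) = ∮ z in C(0, R), f z := by
  have hmap : ∀ θ : ℝ, circleMap 0 (‖p‖ * R) (θ + p.arg) = p * circleMap 0 R θ := by
    intro θ
    conv_rhs => rw [← Complex.norm_mul_exp_arg_mul_I p]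
    simp only [circleMap, zero_add]
    push_cast
    rw [add_mul, Complex.exp_add]
    ring
  set F : ℝ → ℂ := fun θ ↦ deriv (circleMap 0 (‖p‖ * R)) θ • f (circleMap 0 (‖p‖ * R) θ)
  have hF : F.Periodic (2 * Real.pi) := fun θ ↦ by
    simp only [F, deriv_circleMap, periodic_circleMap 0 (‖p‖ * R) θ]
  have h1 := hF.intervalIntegral_add_eq 0 p.arg
  rw [zero_add, add_comm p.arg] at h1
  have h2 := intervalIntegral.integral_comp_add_right F p.arg (a := 0) (b := 2 * Real.pi)
  rw [zero_add] at h2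
  rw [circleIntegral, circleIntegral, h1, ← h2]
  refine intervalIntegral.integral_congr fun θ _ ↦ ?_
  simp only [F, deriv_circleMap, hmap, smul_eq_mul]
  rw [← hf (circleMap 0 R θ) (by simp)]
  ring

end Residues

/-! ### The Jacobi triple product -/

section TripleProduct

open Filter Topology Finset

/-- The Gaussian binomial coefficient, defined by the `q`-analogue of Pascal's rule. -/
noncomputable def gaussBinom (q : ℂ) : ℕ → ℕ → ℂ
  | _, 0 => 1
  | 0, _ + 1 => 0
  | N + 1, k + 1 => gaussBinom q N k + q ^ (k + 1) * gaussBinom q N (k + 1)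

/-- The finite product `(q; q)_n = ∏_{k = 1}^n (1 - q^k)`. -/
noncomputable def qFactorial (q : ℂ) (n : ℕ) : ℂ := ∏ k ∈ range n, (1 - q * q ^ k)

lemma gaussBinom_zero_right (q : ℂ) (N : ℕ) : gaussBinom q N 0 = 1 := by
  cases N <;> rfl

lemma gaussBinom_eq_zero_of_lt (q : ℂ) {N k : ℕ} (h : N < k) : gaussBinom q N k = 0 := by
  induction N generalizing k with
  | zero => obtain ⟨k, rfl⟩ := Nat.exists_eq_succ_of_ne_zero h.ne'; rfl
  | succ N ih =>
    obtain ⟨k, rfl⟩ := Nat.exists_eq_succ_of_ne_zero (Nat.ne_zero_of_lt h)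
    rw [gaussBinom, ih (by omega), ih (by omega), mul_zero, add_zero]

lemma gaussBinom_mul_qFactorial (q : ℂ) (i j : ℕ) :
    gaussBinom q (i + j) i * (qFactorial q i * qFactorial q j) = qFactorial q (i + j) := by
  induction hN : i + j generalizing i j with
  | zero =>
    obtain ⟨rfl, rfl⟩ : i = 0 ∧ j = 0 := by omega
    simp [gaussBinom, qFactorial]
  | succ N ih =>
    rcases i with _ | i
    · obtain rfl : j = N + 1 := by omega
      simp [gaussBinom, qFactorial]
    · rw [gaussBinom]
      have h1 := ih i j (by omega)
      rcases j with _ | j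
      · obtain rfl : i = N := by omega
        rw [gaussBinom_eq_zero_of_lt q (Nat.lt_succ_self i)]
        simp only [qFactorial, prod_range_succ, prod_range_zero] at h1 ⊢
        linear_combination (1 - q * q ^ i) * h1
      · have h2 := ih (i + 1) j (by omega)
        obtain rfl : N = i + j + 1 := by omega
        simp only [qFactorial, prod_range_succ] at h1 h2 ⊢
        linear_combination (1 - q * q ^ i) * h1 + q ^ (i + 1) * (1 - q * q ^ j) * h2

/-- Rothe's `q`-binomial theorem. -/
lemma prod_one_add_eq_sum_gaussBinom (q y : ℂ) (N : ℕ) :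
    ∏ k ∈ range N, (1 + y * q ^ k) =
      ∑ k ∈ range (N + 1), gaussBinom q N k * q ^ k.choose 2 * y ^ k := by
  induction N generalizing y with
  | zero => simp [gaussBinom]
  | succ N ih =>
    have hch : ∀ k : ℕ, (k + 1).choose 2 = k + k.choose 2 := fun k ↦ by
      rw [Nat.choose_succ_succ' k 1, Nat.choose_one_right]
    have h1 : ∏ k ∈ range N, (1 + y * q ^ (k + 1)) =
        ∑ k ∈ range (N + 1), gaussBinom q N k * q ^ k.choose 2 * (y * q) ^ k := by
      rw [← ih (y * q)]
      exact prod_congr rfl fun k _ ↦ by ring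
    have h2 : ∑ k ∈ range (N + 1), gaussBinom q N k * q ^ k.choose 2 * (y * q) ^ k =
        ∑ k ∈ range (N + 1), gaussBinom q N (k + 1) * q ^ (k + 1).choose 2 * (y * q) ^ (k + 1)
          + 1 := by
      have := sum_range_succ (fun k ↦ gaussBinom q N k * q ^ k.choose 2 * (y * q) ^ k) (N + 1)
      rw [gaussBinom_eq_zero_of_lt q (Nat.lt_succ_self N), zero_mul, zero_mul, add_zero] at this
      rw [← this, sum_range_succ']
      simp [gaussBinom_zero_right]
    rw [prod_range_succ', sum_range_succ', h1, pow_zero, mul_one, mul_add, mul_one]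
    nth_rw 1 [h2]
    rw [sum_mul, add_right_comm, ← sum_add_distrib, gaussBinom_zero_right]
    simp only [Nat.choose_zero_succ, pow_zero, mul_one]
    congr 1
    refine sum_congr rfl fun k _ ↦ ?_
    rw [gaussBinom, hch]
    ring

/-- The finite form of the Jacobi triple product. -/
lemma prod_mul_prod_eq_sum_gaussBinom {h x : ℂ} (hh : h ≠ 0) (hx : x ≠ 0) (n : ℕ) :
    (∏ k ∈ range n, (1 - -h * x * (h ^ 2) ^ k)) * ∏ k ∈ range n, (1 - -h / x * (h ^ 2) ^ k) =
      ∑ k ∈ range (2 * n + 1), gaussBinom (h ^ 2) (2 * n) k *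
        (h ^ (((k : ℤ) - n) ^ 2) * x ^ ((k : ℤ) - n)) := by
  -- Shifting the argument by `h ^ (1 - 2n)` makes the product symmetric about the exponent `0`.
  have key := prod_one_add_eq_sum_gaussBinom (h ^ 2) (h ^ (1 - 2 * n : ℤ) * x) (2 * n)
  have hodd : ∀ m : ℕ, ∏ k ∈ range m, h ^ (2 * k + 1) = h ^ (m ^ 2) := by
    intro m
    induction m with
    | zero => simp
    | succ m ih => rw [prod_range_succ, ih, ← pow_add]; congr 1; ring
  have hupper : ∏ k ∈ range n, (1 + h ^ (1 - 2 * n : ℤ) * x * (h ^ 2) ^ (n + k)) =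
      ∏ k ∈ range n, (1 - -h * x * (h ^ 2) ^ k) := by
    refine prod_congr rfl fun k _ ↦ ?_
    have : h ^ (1 - 2 * n : ℤ) * (h ^ 2) ^ (n + k) = h * (h ^ 2) ^ k := by
      rw [zpow_sub₀ hh, zpow_one, show (2 * n : ℤ) = ((2 * n : ℕ) : ℤ) by push_cast; rfl,
        zpow_natCast, pow_add, ← pow_mul]
      field_simp
    linear_combination x * this
  have hlower : h ^ (n ^ 2) * ∏ k ∈ range n, (1 + h ^ (1 - 2 * n : ℤ) * x * (h ^ 2) ^ k) =
      x ^ n * ∏ k ∈ range n, (1 - -h / x * (h ^ 2) ^ k) := by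
    rw [← hodd, ← prod_range_reflect (fun k ↦ 1 + h ^ (1 - 2 * n : ℤ) * x * (h ^ 2) ^ k),
      ← prod_mul_distrib, ← card_range n, ← prod_const, card_range, ← prod_mul_distrib]
    refine prod_congr rfl fun k hk ↦ ?_
    have hk : k < n := mem_range.1 hk
    have : h ^ (2 * k + 1) * (h ^ (1 - 2 * n : ℤ) * (h ^ 2) ^ (n - 1 - k)) = 1 := by
      rw [← zpow_natCast, ← pow_mul, ← zpow_natCast, ← zpow_add₀ hh, ← zpow_add₀ hh,
        ← zpow_zero h]
      congr 1
      push_cast [Nat.cast_sub (show k ≤ n - 1 by omega), Nat.cast_sub (show 1 ≤ n by omega)]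
      ring
    have hxx : x * x⁻¹ = 1 := mul_inv_cancel₀ hx
    rw [div_eq_mul_inv]
    linear_combination x * this - h ^ (2 * k + 1) * hxx
  rw [show range (2 * n) = range (n + n) by rw [two_mul], prod_range_add, hupper] at key
  have h1 : x ^ n ≠ 0 := pow_ne_zero _ hx
  have h2 : h ^ n ^ 2 ≠ 0 := pow_ne_zero _ hh
  apply mul_left_cancel₀ h1
  rw [mul_left_comm, ← hlower, mul_left_comm, mul_comm (∏ k ∈ range n, _) (∏ k ∈ range n, _), key,
    mul_sum, mul_sum]
  refine sum_congr rfl fun k _ ↦ ?_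
  have e1 : x ^ n * x ^ ((k : ℤ) - n) = x ^ k := by
    rw [← zpow_natCast, ← zpow_natCast, ← zpow_add₀ hx]
    congr 1
    ring
  have e2 : h ^ n ^ 2 * ((h ^ 2) ^ k.choose 2 * (h ^ (1 - 2 * n : ℤ)) ^ k) =
      h ^ (((k : ℤ) - n) ^ 2) := by
    have hch : (2 * k.choose 2 : ℤ) = k * (k - 1) := by
      rcases k with _ | k
      · simp
      · have := Nat.choose_two_right (k + 1)
        have h3 : 2 * (k + 1).choose 2 = (k + 1) * k := by
          rw [this, Nat.add_sub_cancel]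
          exact Nat.mul_div_cancel' (by rw [mul_comm]; exact (Nat.even_mul_succ_self k).two_dvd)
        push_cast
        rw [show ((k : ℤ) + 1 - 1) = k by ring]
        exact_mod_cast h3
    rw [← pow_mul, ← zpow_natCast, ← zpow_natCast, ← zpow_natCast, ← zpow_mul, ← zpow_add₀ hh,
      ← zpow_add₀ hh]
    congr 1
    push_cast
    linear_combination hch
  rw [mul_pow, ← e1, ← e2]
  ring

lemma tendsto_qFactorial {q : ℂ} (hq : ‖q‖ < 1) :
    Tendsto (qFactorial q) atTop (𝓝 (eulerProd q)) :=
  tendsto_prod_qPoch q hq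

lemma qFactorial_ne_zero {q : ℂ} (hq : ‖q‖ < 1) (n : ℕ) : qFactorial q n ≠ 0 := by
  refine prod_ne_zero_iff.2 fun k _ ↦ sub_ne_zero.2 fun h ↦ ?_
  have h1 : ‖q‖ ^ (k + 1) = 1 := by simpa [pow_succ'] using (congrArg norm h).symm
  exact (pow_lt_one₀ (norm_nonneg q) hq k.succ_ne_zero).ne h1

lemma exists_norm_gaussBinom_le {q : ℂ} (hq : ‖q‖ < 1) :
    ∃ C, ∀ N k, ‖gaussBinom q N k‖ ≤ C := by
  have hE := eulerProd_ne_zero hq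
  obtain ⟨A, hA⟩ := (tendsto_qFactorial hq).norm.bddAbove_range
  obtain ⟨B, hB⟩ := ((tendsto_qFactorial hq).inv₀ hE).norm.bddAbove_range
  have hA' : ∀ n, ‖qFactorial q n‖ ≤ A := fun n ↦ hA ⟨n, rfl⟩
  have hB' : ∀ n, ‖(qFactorial q n)⁻¹‖ ≤ B := fun n ↦ hB ⟨n, rfl⟩
  have hA0 : 0 ≤ A := (norm_nonneg _).trans (hA' 0)
  have hB0 : 0 ≤ B := (norm_nonneg _).trans (hB' 0)
  refine ⟨A * (B * B), fun N k ↦ ?_⟩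
  rcases lt_or_ge N k with h | h
  · rw [gaussBinom_eq_zero_of_lt q h, norm_zero]
    positivity
  · obtain ⟨j, rfl⟩ := Nat.exists_eq_add_of_le h
    have h1 := qFactorial_ne_zero hq k
    have h2 := qFactorial_ne_zero hq j
    have : gaussBinom q (k + j) k =
        qFactorial q (k + j) * ((qFactorial q k)⁻¹ * (qFactorial q j)⁻¹) := by
      rw [← gaussBinom_mul_qFactorial]
      field_simp
    rw [this, norm_mul, norm_mul]
    gcongr
    exacts [hA' _, hB' _, hB' _]

lemma tendsto_gaussBinom_central {q : ℂ} (hq : ‖q‖ < 1) (j : ℤ) :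
    Tendsto (fun n : ℕ ↦ gaussBinom q (2 * n) (j + n).toNat) atTop (𝓝 (eulerProd q)⁻¹) := by
  have hE := eulerProd_ne_zero hq
  have hlim : ∀ i : ℤ, Tendsto (fun n : ℕ ↦ (i + n).toNat) atTop atTop := fun i ↦ by
    refine tendsto_atTop.2 fun b ↦ ?_
    filter_upwards [eventually_ge_atTop (b + i.natAbs)] with n hn
    omega
  have h2 : Tendsto (fun n : ℕ ↦ 2 * n) atTop atTop := tendsto_id.const_mul_atTop' (by norm_num)
  have hF := tendsto_qFactorial hq
  have := (hF.comp h2).mul (((hF.comp (hlim j)).inv₀ hE).mul ((hF.comp (hlim (-j))).inv₀ hE))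
  rw [show eulerProd q * ((eulerProd q)⁻¹ * (eulerProd q)⁻¹) = (eulerProd q)⁻¹ by
    field_simp] at this
  refine this.congr' ?_
  filter_upwards [eventually_ge_atTop j.natAbs] with n hn
  simp only [Function.comp]
  have h3 := gaussBinom_mul_qFactorial q (j + n).toNat (-j + n).toNat
  rw [show (j + n).toNat + (-j + n).toNat = 2 * n by omega] at h3
  have h4 := qFactorial_ne_zero hq (j + n).toNat
  have h5 := qFactorial_ne_zero hq (-j + n).toNat
  rw [← h3]
  field_simp

/-- The Jacobi triple product: the limit `n → ∞` of its finite form, by dominated convergence. -/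
lemma tsum_eq_eulerProd_mul_thetaProd {h x : ℂ} (hh : h ≠ 0) (hh1 : ‖h‖ < 1) (hx : x ≠ 0)
    (hs : Summable fun j : ℤ ↦ h ^ (j ^ 2) * x ^ j) :
    ∑' j : ℤ, h ^ (j ^ 2) * x ^ j = eulerProd (h ^ 2) * thetaProd (-h * x) (h ^ 2) := by
  have hq : ‖h ^ 2‖ < 1 := by simpa using pow_lt_one₀ (norm_nonneg h) hh1 two_ne_zero
  set q := h ^ 2 with hqdef
  set f : ℕ → ℤ → ℂ := fun n j ↦
    if -(n : ℤ) ≤ j then gaussBinom q (2 * n) (j + n).toNat * (h ^ (j ^ 2) * x ^ j) else 0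
    with hf
  have hfsum : ∀ n, ∑' j, f n j = (∏ k ∈ range n, (1 - -h * x * q ^ k)) *
      ∏ k ∈ range n, (1 - -h / x * q ^ k) := by
    intro n
    rw [prod_mul_prod_eq_sum_gaussBinom hh hx]
    have hinj : Function.Injective fun k : ℕ ↦ (k : ℤ) - n := fun a b hab ↦ by
      simpa using hab
    rw [← hinj.tsum_eq (f := f n), tsum_eq_sum (s := range (2 * n + 1))]
    · refine sum_congr rfl fun k _ ↦ ?_
      simp [hf, hqdef]
    · intro k hk
      rw [mem_range, not_lt] at hk
      simp [hf, gaussBinom_eq_zero_of_lt q (show 2 * n < k by omega)]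
    · intro j hj
      refine ⟨(j + n).toNat, ?_⟩
      have : -(n : ℤ) ≤ j := by
        by_contra hlt
        exact hj (if_neg hlt)
      simp only
      omega
  obtain ⟨C, hC⟩ := exists_norm_gaussBinom_le hq
  have hlim : Tendsto (fun n ↦ ∑' j, f n j) atTop
      (𝓝 (∑' j : ℤ, (eulerProd q)⁻¹ * (h ^ (j ^ 2) * x ^ j))) := by
    refine tendsto_tsum_of_dominated_convergence (hs.norm.mul_left C) (fun j ↦ ?_)
      (.of_forall fun n j ↦ ?_)
    · refine ((tendsto_gaussBinom_central hq j).mul_const _).congr' ?_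
      filter_upwards [eventually_ge_atTop j.natAbs] with n hn
      rw [hf]
      exact (if_pos (by omega)).symm
    · rw [hf]
      dsimp only
      split_ifs
      · rw [norm_mul]
        exact mul_le_mul_of_nonneg_right (hC _ _) (norm_nonneg _)
      · rw [norm_zero]
        exact mul_nonneg ((norm_nonneg _).trans (hC 0 0)) (norm_nonneg _)
  simp only [hfsum] at hlim
  have huniq := tendsto_nhds_unique hlim
    ((tendsto_prod_qPoch (-h * x) hq).mul (tendsto_prod_qPoch (-h / x) hq))
  rw [tsum_mul_left] at huniq
  rw [thetaProd, show q / (-h * x) = -h / x by rw [hqdef]; field_simp, ← huniq,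
    mul_inv_cancel_left₀ (eulerProd_ne_zero hq)]

end TripleProduct

/-! ### Theta constants and the eta function as products -/

section ThetaConstants

open Complex

/-- `h = exp (π i τ)`, the square root of the nome `q`. -/
noncomputable def halfNome (τ : ℂ) : ℂ := cexp (Real.pi * I * τ)

lemma halfNome_ne_zero (τ : ℂ) : halfNome τ ≠ 0 := exp_ne_zero _

lemma norm_halfNome_lt_one {τ : ℂ} (hτ : 0 < τ.im) : ‖halfNome τ‖ < 1 := by
  rw [halfNome, norm_exp, Real.exp_lt_one_iff]
  simpa [mul_re, mul_im] using mul_pos Real.pi_pos hτ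

lemma halfNome_mul (n : ℕ) (τ : ℂ) : halfNome (n * τ) = halfNome τ ^ n := by
  rw [halfNome, halfNome, ← exp_nat_mul]
  ring_nf

lemma nomePow_eq_halfNome_pow (τ : ℂ) {r : ℝ} {n : ℕ} (hr : 2 * r = n) :
    nomePow τ r = halfNome τ ^ n := by
  have : (2 * r : ℂ) = n := by exact_mod_cast hr
  rw [nomePow, halfNome, ← exp_nat_mul, ← this]
  ring_nf

lemma nomePow_add (τ : ℂ) (r s : ℝ) : nomePow τ (r + s) = nomePow τ r * nomePow τ s := by
  rw [nomePow, nomePow, nomePow, ← exp_add]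
  push_cast
  ring_nf

lemma summable_halfNome_zpow {τ x : ℂ} (hτ : 0 < τ.im) (hx : x ≠ 0) :
    Summable fun j : ℤ ↦ halfNome τ ^ (j ^ 2) * x ^ j := by
  refine ((summable_jacobiTheta₂_term_iff (log x / (2 * Real.pi * I)) τ).2 hτ).congr fun j ↦ ?_
  have hz : x = cexp (2 * Real.pi * I * (log x / (2 * Real.pi * I))) := by
    rw [mul_div_cancel₀ _ two_pi_I_ne_zero, exp_log hx]
  conv_rhs => rw [hz]
  rw [jacobiTheta₂_term, halfNome, ← exp_int_mul, ← exp_int_mul, ← exp_add]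
  push_cast
  ring_nf

lemma tsum_halfNome_zpow {τ x : ℂ} (hτ : 0 < τ.im) (hx : x ≠ 0) :
    ∑' j : ℤ, halfNome τ ^ (j ^ 2) * x ^ j =
      eulerProd (halfNome τ ^ 2) * thetaProd (-halfNome τ * x) (halfNome τ ^ 2) :=
  tsum_eq_eulerProd_mul_thetaProd (halfNome_ne_zero τ) (norm_halfNome_lt_one hτ) hx
    (summable_halfNome_zpow hτ hx)

lemma tsum_int_eq_zero_add_two_mul {f : ℤ → ℂ} (hf : Summable f) (heven : ∀ j, f (-j) = f j) :
    ∑' j : ℤ, f j = f 0 + 2 * ∑' n : ℕ, f (n + 1) := by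
  have h1 : Summable fun n : ℕ ↦ f (n + 1) := hf.comp_injective (i := fun n : ℕ ↦ (n : ℤ) + 1)
    fun a b hab ↦ by simpa using hab
  rw [tsum_of_add_one_of_neg_add_one h1 (by simpa only [heven] using h1)]
  simp only [heven]
  ring

lemma vartheta3_eq {τ : ℂ} (hτ : 0 < τ.im) : vartheta3 τ =
    eulerProd (halfNome τ ^ 2) * thetaProd (-halfNome τ) (halfNome τ ^ 2) := by
  have h := tsum_halfNome_zpow hτ one_ne_zero
  rw [tsum_int_eq_zero_add_two_mul (summable_halfNome_zpow hτ one_ne_zero) (by simp), mul_one] at h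
  rw [← h, vartheta3, theta3]
  simp only [mul_zero, cos_zero, mul_one, one_zpow]
  norm_num
  refine tsum_congr fun n ↦ ?_
  rw [nomePow_eq_halfNome_pow τ (n := (n + 1) ^ 2) (by push_cast; ring)]
  exact_mod_cast rfl

lemma vartheta4_eq {τ : ℂ} (hτ : 0 < τ.im) : vartheta4 τ =
    eulerProd (halfNome τ ^ 2) * thetaProd (halfNome τ) (halfNome τ ^ 2) := by
  have h1 : (-1 : ℂ) ≠ 0 := by norm_num
  have h := tsum_halfNome_zpow hτ h1
  rw [tsum_int_eq_zero_add_two_mul (summable_halfNome_zpow hτ h1)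
    (fun j ↦ by simp [← inv_zpow]), neg_mul_neg, mul_one] at h
  rw [← h, vartheta4, theta4]
  simp only [mul_zero, cos_zero, mul_one]
  norm_num
  refine tsum_congr fun n ↦ ?_
  rw [nomePow_eq_halfNome_pow τ (n := (n + 1) ^ 2) (by push_cast; ring), mul_comm]
  exact_mod_cast rfl

lemma vartheta2_eq {τ : ℂ} (hτ : 0 < τ.im) : vartheta2 τ =
    nomePow τ (1 / 8) * (eulerProd (halfNome τ ^ 2) * thetaProd (-1) (halfNome τ ^ 2)) := by
  have hh := halfNome_ne_zero τ
  have hq : ‖halfNome τ ^ 2‖ < 1 := by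
    simpa using pow_lt_one₀ (norm_nonneg _) (norm_halfNome_lt_one hτ) two_ne_zero
  have h := tsum_halfNome_zpow hτ hh
  have hs := summable_halfNome_zpow hτ hh
  have e1 : ∀ n : ℕ, halfNome τ ^ ((n : ℤ) ^ 2) * halfNome τ ^ (n : ℤ) =
      halfNome τ ^ (n ^ 2 + n) := fun n ↦ by
    rw [pow_add]
    exact_mod_cast rfl
  -- The terms of index `n` and `-(n + 1)` agree.
  have e2 : ∀ n : ℕ, halfNome τ ^ ((-((n : ℤ) + 1)) ^ 2) * halfNome τ ^ (-((n : ℤ) + 1)) =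
      halfNome τ ^ (n ^ 2 + n) := fun n ↦ by
    rw [← zpow_add₀ hh, ← zpow_natCast]
    congr 1
    push_cast
    ring
  have h1 : Summable fun n : ℕ ↦ halfNome τ ^ (n ^ 2 + n) := by
    simpa only [Function.comp_def, e1] using
      hs.comp_injective (Nat.cast_injective (R := ℤ))
  rw [tsum_of_nat_of_neg_add_one
    (f := fun j : ℤ ↦ halfNome τ ^ (j ^ 2) * halfNome τ ^ j) (by simpa only [e1] using h1)
    (by simpa only [e2] using h1)] at h
  simp only [e1, e2] at h
  rw [show -halfNome τ * halfNome τ = halfNome τ ^ 2 * -1 by ring,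
    thetaProd_mul_left hq (pow_ne_zero _ hh) (by norm_num)] at h
  norm_num at h
  rw [← h, vartheta2, theta2, ← two_mul, mul_left_comm]
  congr 1
  rw [← tsum_mul_left]
  refine tsum_congr fun n ↦ ?_
  rw [mul_zero, cos_zero, mul_one, ← nomePow_eq_halfNome_pow τ (r := (n ^ 2 + n) / 2)
    (by push_cast; ring), ← nomePow_add]
  congr 1
  ring

lemma eta_eq (τ : ℂ) :
    ModularForm.eta τ = nomePow τ (1 / 24) * eulerProd (halfNome τ ^ 2) := by
  have hq : cexp (2 * Real.pi * I * τ) = halfNome τ ^ 2 := by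
    rw [halfNome, ← exp_nat_mul]
    push_cast
    ring_nf
  rw [ModularForm.eta, eulerProd, qPoch]
  congr 1
  · rw [Function.Periodic.qParam, nomePow]
    push_cast
    ring_nf
  · refine tprod_congr fun n ↦ ?_
    rw [ModularForm.eta_q_eq_pow, hq, pow_succ']

end ThetaConstants

/-! ### The elliptic function and its residues -/

section EllipticFunction

open Filter Topology

/-- The function `w⁻² Θ(w⁷; q²¹) / (Θ(w; q) Θ(w²; q³))`, which is invariant under `w ↦ q³ w`,
divided by `w`, so that its residues are those of the invariant differential form. -/
noncomputable def quotientForm (q w : ℂ) : ℂ :=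
  (w ^ 3)⁻¹ * thetaProd (w ^ 7) (q ^ 21) / (thetaProd w q * thetaProd (w ^ 2) (q ^ 3))

lemma norm_pow_lt_one {q : ℂ} (hq : ‖q‖ < 1) {n : ℕ} (hn : n ≠ 0) : ‖q ^ n‖ < 1 := by
  simpa using pow_lt_one₀ (norm_nonneg q) hq hn

lemma quotientForm_mul {q w : ℂ} (hq : ‖q‖ < 1) (hq0 : q ≠ 0) (hw : w ≠ 0) :
    q ^ 3 * quotientForm q (q ^ 3 * w) = quotientForm q w := by
  have h1 : thetaProd ((q ^ 3 * w) ^ 7) (q ^ 21) = -(w ^ 7)⁻¹ * thetaProd (w ^ 7) (q ^ 21) := by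
    rw [← thetaProd_mul_left (norm_pow_lt_one hq (by norm_num)) (pow_ne_zero _ hq0)
      (pow_ne_zero _ hw)]
    ring_nf
  have h2 : thetaProd (q ^ 3 * w) q = -(q ^ 3 * w ^ 3)⁻¹ * thetaProd w q := by
    rw [show q ^ 3 * w = q * (q * (q * w)) by ring,
      thetaProd_mul_left hq hq0 (by simp [hq0, hw]), thetaProd_mul_left hq hq0 (by simp [hq0, hw]),
      thetaProd_mul_left hq hq0 hw]
    field_simp
  have h3 : thetaProd ((q ^ 3 * w) ^ 2) (q ^ 3) =
      (q ^ 3 * w ^ 4)⁻¹ * thetaProd (w ^ 2) (q ^ 3) := by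
    have hq3 : q ^ 3 ≠ 0 := pow_ne_zero _ hq0
    rw [show (q ^ 3 * w) ^ 2 = q ^ 3 * (q ^ 3 * w ^ 2) by ring,
      thetaProd_mul_left (norm_pow_lt_one hq (by norm_num)) hq3 (by simp [hq0, hw]),
      thetaProd_mul_left (norm_pow_lt_one hq (by norm_num)) hq3 (by simp [hw])]
    field_simp
  rw [quotientForm, quotientForm, h1, h2, h3]
  field_simp

lemma differentiableAt_thetaProd_pow {q w : ℂ} (hq : ‖q‖ < 1) (hw : w ≠ 0) (m : ℕ) {n : ℕ}
    (hn : n ≠ 0) : DifferentiableAt ℂ (fun w ↦ thetaProd (w ^ m) (q ^ n)) w :=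
  DifferentiableAt.comp (g := fun x ↦ thetaProd x (q ^ n)) w
    (differentiableAt_thetaProd (norm_pow_lt_one hq hn) (pow_ne_zero m hw))
    (differentiableAt_pow m)

lemma differentiableAt_quotientForm {q w : ℂ} (hq : ‖q‖ < 1) (hw : w ≠ 0)
    (h1 : thetaProd w q ≠ 0) (h2 : thetaProd (w ^ 2) (q ^ 3) ≠ 0) :
    DifferentiableAt ℂ (quotientForm q) w := by
  have d1 := differentiableAt_thetaProd hq hw
  have d2 := differentiableAt_thetaProd_pow hq hw 2 three_ne_zero
  have d3 := differentiableAt_thetaProd_pow hq hw 7 (n := 21) (by norm_num)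
  have h3 : w ^ 3 ≠ 0 := pow_ne_zero 3 hw
  have h4 : DifferentiableAt ℂ (fun w : ℂ ↦ (w ^ 3)⁻¹) w := by fun_prop (disch := assumption)
  exact (h4.mul d3).div (d1.mul d2) (mul_ne_zero h1 h2)

lemma tendsto_div_sub_of_hasDerivAt {f : ℂ → ℂ} {a d : ℂ} (hf : HasDerivAt f d a) (h0 : f a = 0) :
    Tendsto (fun z ↦ f z / (z - a)) (𝓝[≠] a) (𝓝 d) := by
  refine (hasDerivAt_iff_tendsto_slope.1 hf).congr fun z ↦ ?_
  rw [slope_def_field, h0, sub_zero]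

lemma tendsto_sub_mul_div {f g : ℂ → ℂ} {a d : ℂ} (hf : ContinuousAt f a)
    (hg : HasDerivAt g d a) (h0 : g a = 0) (hd : d ≠ 0) :
    Tendsto (fun z ↦ (z - a) * (f z / g z)) (𝓝[≠] a) (𝓝 (f a / d)) := by
  refine ((hf.tendsto.mono_left nhdsWithin_le_nhds).div
    (tendsto_div_sub_of_hasDerivAt hg h0) hd).congr fun z ↦ ?_
  rw [Pi.div_apply, div_div_eq_mul_div, mul_comm (f z), mul_div_assoc]

lemma hasDerivAt_thetaProd_pow {q a d : ℂ} (n : ℕ)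
    (h : HasDerivAt (fun x ↦ thetaProd x q) d (a ^ n)) :
    HasDerivAt (fun x ↦ thetaProd (x ^ n) q) (d * (n * a ^ (n - 1))) a :=
  HasDerivAt.comp (h₂ := fun x ↦ thetaProd x q) a h (hasDerivAt_pow n a)

lemma hasDerivAt_thetaProd_self {q : ℂ} (hq : ‖q‖ < 1) (hq0 : q ≠ 0) :
    HasDerivAt (fun x ↦ thetaProd x q) (eulerProd q ^ 2 / q) q := by
  have := hasDerivAt_thetaProd_mul_left hq hq0 one_ne_zero (thetaProd_one hq)
    (hasDerivAt_thetaProd_one hq)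
  rw [mul_one] at this
  exact this.congr_deriv (by norm_num)

lemma thetaProd_self {q : ℂ} (hq : ‖q‖ < 1) (hq0 : q ≠ 0) : thetaProd q q = 0 := by
  have := thetaProd_mul_left hq hq0 one_ne_zero
  rwa [thetaProd_one hq, mul_zero, mul_one] at this

lemma hasDerivAt_thetaProd_sq {q : ℂ} (hq : ‖q‖ < 1) (hq0 : q ≠ 0) :
    HasDerivAt (fun x ↦ thetaProd x q) (-eulerProd q ^ 2 / q ^ 3) (q ^ 2) := by
  have := hasDerivAt_thetaProd_mul_left hq hq0 hq0 (thetaProd_self hq hq0)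
    (hasDerivAt_thetaProd_self hq hq0)
  rw [← sq] at this
  exact this.congr_deriv (by field_simp)

/-- The residue at `w = 1`, where a simple zero of the numerator meets a double zero of the
denominator. -/
lemma tendsto_quotientForm_one {q : ℂ} (hq : ‖q‖ < 1) :
    Tendsto (fun w ↦ (w - 1) * quotientForm q w) (𝓝[≠] 1)
      (𝓝 (-(7 / 2) * eulerProd (q ^ 21) ^ 2 / (eulerProd q ^ 2 * eulerProd (q ^ 3) ^ 2))) := by
  have hq3 := norm_pow_lt_one hq three_ne_zero
  have hq21 := norm_pow_lt_one hq (n := 21) (by norm_num)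
  have E1 := eulerProd_ne_zero hq
  have E3 := eulerProd_ne_zero hq3
  have d1 := tendsto_div_sub_of_hasDerivAt (hasDerivAt_thetaProd_one hq) (thetaProd_one hq)
  have d2 := tendsto_div_sub_of_hasDerivAt (hasDerivAt_thetaProd_pow (a := 1) 2
    (by simpa using hasDerivAt_thetaProd_one hq3)) (by simpa using thetaProd_one hq3)
  have d3 := tendsto_div_sub_of_hasDerivAt (hasDerivAt_thetaProd_pow (a := 1) 7
    (by simpa using hasDerivAt_thetaProd_one hq21)) (by simpa using thetaProd_one hq21)
  have hc : ContinuousAt (fun w : ℂ ↦ (w ^ 3)⁻¹) 1 := by fun_prop (disch := norm_num)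
  have h := ((hc.tendsto.mono_left nhdsWithin_le_nhds).mul d3).div (d1.mul d2)
    (by simp [E1, E3])
  refine (h.congr' ?_).trans_eq ?_
  · filter_upwards [self_mem_nhdsWithin] with w hw
    have : w - 1 ≠ 0 := sub_ne_zero.2 hw
    simp only [Pi.div_apply, quotientForm]
    field_simp
  · congr 1
    norm_num
    field_simp

/-- The residues at the points whose square is `1` or `q³`, apart from `w = 1`. -/
lemma tendsto_quotientForm_of_sq {q a d : ℂ} (hq : ‖q‖ < 1) (ha : a ≠ 0)
    (h1 : thetaProd a q ≠ 0) (h2 : thetaProd (a ^ 2) (q ^ 3) = 0) (hd0 : d ≠ 0)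
    (hd : HasDerivAt (fun x ↦ thetaProd x (q ^ 3)) d (a ^ 2)) :
    Tendsto (fun w ↦ (w - a) * quotientForm q w) (𝓝[≠] a)
      (𝓝 ((a ^ 3)⁻¹ * thetaProd (a ^ 7) (q ^ 21) / thetaProd a q / (d * (2 * a)))) := by
  have c1 := (differentiableAt_thetaProd hq ha).continuousAt
  have c3 := (differentiableAt_thetaProd_pow hq ha 7 (n := 21) (by norm_num)).continuousAt
  have h3 : a ^ 3 ≠ 0 := pow_ne_zero 3 ha
  have h4 : ContinuousAt (fun w : ℂ ↦ (w ^ 3)⁻¹) a := by fun_prop (disch := assumption)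
  have := tendsto_sub_mul_div ((h4.mul c3).div c1 h1) (hasDerivAt_thetaProd_pow 2 hd) h2
    (by simpa [hd0] using ha)
  refine (this.congr fun w ↦ ?_).trans_eq (by simp)
  simp only [Pi.div_apply, Pi.mul_apply, quotientForm, div_div]

/-- The residues at the points `a = q` and `a = q²`. -/
lemma tendsto_quotientForm_of_zero {q a d : ℂ} (hq : ‖q‖ < 1) (ha : a ≠ 0)
    (h1 : thetaProd a q = 0) (h2 : thetaProd (a ^ 2) (q ^ 3) ≠ 0) (hd0 : d ≠ 0)
    (hd : HasDerivAt (fun x ↦ thetaProd x q) d a) :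
    Tendsto (fun w ↦ (w - a) * quotientForm q w) (𝓝[≠] a)
      (𝓝 ((a ^ 3)⁻¹ * thetaProd (a ^ 7) (q ^ 21) / thetaProd (a ^ 2) (q ^ 3) / d)) := by
  have c2 := (differentiableAt_thetaProd_pow hq ha 2 three_ne_zero).continuousAt
  have c3 := (differentiableAt_thetaProd_pow hq ha 7 (n := 21) (by norm_num)).continuousAt
  have h3 : a ^ 3 ≠ 0 := pow_ne_zero 3 ha
  have h4 : ContinuousAt (fun w : ℂ ↦ (w ^ 3)⁻¹) a := by fun_prop (disch := assumption)
  refine (tendsto_sub_mul_div ((h4.mul c3).div c2 h2) hd h1 hd0).congr fun w ↦ ?_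
  simp only [Pi.div_apply, Pi.mul_apply, quotientForm, div_div]
  rw [mul_comm (thetaProd w q)]

lemma eq_of_mul_zpow_eq_zpow {h : ℂ} (hh : h ≠ 0) (hh1 : ‖h‖ < 1) {u : ℂ} (hu : ‖u‖ = 1)
    {m n : ℤ} (e : u * h ^ m = h ^ n) : m = n := by
  have := congrArg norm e
  rw [norm_mul, hu, one_mul, norm_zpow, norm_zpow] at this
  exact zpow_right_injective₀ (norm_pos_iff.2 hh) hh1.ne this

lemma thetaProd_ne_zero_of_norm_eq {h u : ℂ} (hh : h ≠ 0) (hh1 : ‖h‖ < 1) (hu : ‖u‖ = 1) :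
    thetaProd (u * h) (h ^ 2) ≠ 0 := by
  refine thetaProd_ne_zero (norm_pow_lt_one hh1 two_ne_zero)
    (mul_ne_zero (norm_pos_iff.1 (by rw [hu]; norm_num)) hh) fun n hn ↦ ?_
  have := eq_of_mul_zpow_eq_zpow hh hh1 hu (m := 1) (n := 2 * n)
    (by rw [zpow_one, hn, zpow_mul]; norm_cast)
  omega

lemma thetaProd_neg_one_ne_zero {q : ℂ} (hq0 : q ≠ 0) (hq : ‖q‖ < 1) : thetaProd (-1) q ≠ 0 := by
  refine thetaProd_ne_zero hq (by norm_num) fun n hn ↦ ?_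
  have := eq_of_mul_zpow_eq_zpow hq0 hq (u := -1) (by simp) (m := 0) (n := n) (by simpa using hn)
  subst this
  norm_num at hn

/-- The listed points contain all poles of `quotientForm (h ^ 2)` in the fundamental annulus
`‖h‖ ^ (11 / 2) ≤ ‖w‖ ≤ ‖h‖ ^ (-1 / 2)`, whose boundary circles carry no pole. -/
lemma differentiableAt_quotientForm_of_notMem {h w : ℂ} (hh1 : ‖h‖ < 1) {ρ : ℝ}
    (hρ0 : 0 < ρ) (hρ : ρ ^ 2 = ‖h‖) (hw1 : ρ ^ 11 ≤ ‖w‖) (hw2 : ‖w‖ ≤ ρ⁻¹)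
    (hS : w ∉ ({1, -1, h ^ 3, -h ^ 3, h ^ 2, h ^ 4} : Finset ℂ)) :
    DifferentiableAt ℂ (quotientForm (h ^ 2)) w := by
  have hρ1 : ρ < 1 := by nlinarith
  have hw : w ≠ 0 := norm_pos_iff.1 ((pow_pos hρ0 11).trans_le hw1)
  have hbound : ∀ m : ℤ, ‖w‖ = ‖h‖ ^ m → 0 ≤ m ∧ m ≤ 5 := by
    intro m hm
    rw [← hρ, ← zpow_natCast, ← zpow_mul] at hm
    rw [hm, ← zpow_natCast, zpow_le_zpow_iff_right_of_lt_one₀ hρ0 hρ1] at hw1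
    rw [hm, ← zpow_neg_one, zpow_le_zpow_iff_right_of_lt_one₀ hρ0 hρ1] at hw2
    push_cast at hw1 hw2
    omega
  have hq := norm_pow_lt_one hh1 two_ne_zero
  simp only [Finset.mem_insert, Finset.mem_singleton, not_or] at hS
  obtain ⟨s1, s2, s3, s4, s5, s6⟩ := hS
  refine differentiableAt_quotientForm hq hw ?_ ?_
  · refine thetaProd_ne_zero hq hw fun n hn ↦ ?_
    have hn' : w = h ^ (2 * n) := by rw [hn, zpow_mul]; norm_cast
    have := hbound (2 * n) (by rw [hn', norm_zpow])
    obtain rfl | rfl | rfl : n = 0 ∨ n = 1 ∨ n = 2 := by omega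
    · exact s1 (by simpa using hn')
    · exact s5 (by rw [hn']; norm_cast)
    · exact s6 (by rw [hn']; norm_cast)
  · refine thetaProd_ne_zero (norm_pow_lt_one hq three_ne_zero) (pow_ne_zero 2 hw) fun n hn ↦ ?_
    have hn' : w ^ 2 = (h ^ (3 * n)) ^ 2 := by
      rw [hn, ← pow_mul, ← zpow_natCast, ← zpow_natCast, ← zpow_mul, ← zpow_mul]
      congr 1
      push_cast
      ring
    have hor := sq_eq_sq_iff_eq_or_eq_neg.1 hn'
    have := hbound (3 * n) (by rcases hor with e | e <;> simp [e])
    obtain rfl | rfl : n = 0 ∨ n = 1 := by omega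
    · rcases hor with e | e
      · exact s1 (by simpa using e)
      · exact s2 (by simpa using e)
    · rcases hor with e | e
      · exact s3 (by rw [e]; norm_cast)
      · exact s4 (by rw [e]; norm_cast)

/-- The residues of the invariant form over a fundamental annulus add up to zero, because
`w ↦ q³ w` carries the outer boundary circle into the inner one. -/
lemma sum_residues_quotientForm {h q : ℂ} (hh : h ≠ 0) (hh1 : ‖h‖ < 1) (hqh : q = h ^ 2)
    {r₁ r₂ r₃ r₄ r₅ r₆ : ℂ}
    (h₁ : Tendsto (fun w ↦ (w - 1) * quotientForm q w) (𝓝[≠] 1) (𝓝 r₁))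
    (h₂ : Tendsto (fun w ↦ (w - -1) * quotientForm q w) (𝓝[≠] (-1)) (𝓝 r₂))
    (h₃ : Tendsto (fun w ↦ (w - h ^ 3) * quotientForm q w) (𝓝[≠] (h ^ 3)) (𝓝 r₃))
    (h₄ : Tendsto (fun w ↦ (w - -h ^ 3) * quotientForm q w) (𝓝[≠] (-h ^ 3)) (𝓝 r₄))
    (h₅ : Tendsto (fun w ↦ (w - q) * quotientForm q w) (𝓝[≠] q) (𝓝 r₅))
    (h₆ : Tendsto (fun w ↦ (w - q ^ 2) * quotientForm q w) (𝓝[≠] (q ^ 2)) (𝓝 r₆)) :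
    r₁ + (r₂ + (r₃ + (r₄ + (r₅ + r₆)))) = 0 := by
  subst hqh
  rw [show (h ^ 2) ^ 2 = h ^ 4 by ring] at h₆
  -- The radii are `ρ ^ 11` and `ρ⁻¹`; the poles have absolute values `ρ ^ (2 * n)` with `n < 6`.
  set ρ := √‖h‖
  have hρ0 : 0 < ρ := Real.sqrt_pos.2 (norm_pos_iff.2 hh)
  have hρ : ρ ^ 2 = ‖h‖ := Real.sq_sqrt (norm_nonneg h)
  have hρ1 : ρ < 1 := by nlinarith [norm_nonneg h]
  have hρinv : 1 < ρ⁻¹ := (one_lt_inv₀ hρ0).2 hρ1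
  have hlt : ∀ n : ℕ, n < 6 → ρ ^ 11 < ‖h‖ ^ n ∧ ‖h‖ ^ n < ρ⁻¹ := fun n hn ↦ by
    refine ⟨?_, (pow_le_one₀ (norm_nonneg h) hh1.le).trans_lt hρinv⟩
    rw [← hρ, ← pow_mul]
    exact pow_lt_pow_right_of_lt_one₀ hρ0 hρ1 (by omega)
  have hne : ∀ m n : ℕ, m ≠ n → ∀ u v : ℂ, ‖u‖ = 1 → ‖v‖ = 1 → u * h ^ m ≠ v * h ^ n := by
    intro m n hmn u v hu hv e
    have := congrArg norm e
    rw [norm_mul, norm_mul, hu, hv, one_mul, one_mul, norm_pow, norm_pow] at this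
    exact hmn (pow_right_injective₀ (norm_pos_iff.2 hh) hh1.ne this)
  have hself : ∀ u : ℂ, u ≠ 0 → u ≠ -u := fun u hu e ↦ hu (self_eq_neg.1 e)
  have n1 : ‖(1 : ℂ)‖ = 1 := norm_one
  have n2 : ‖(-1 : ℂ)‖ = 1 := by simp
  have key := circleIntegral_sub_circleIntegral_eq_sum_residues (pow_pos hρ0 11)
    (((hlt 0 (by norm_num)).1.trans (hlt 0 (by norm_num)).2).le)
    {1, -1, h ^ 3, -h ^ 3, h ^ 2, h ^ 4} (by
      intro a ha
      simp only [Finset.mem_insert, Finset.mem_singleton] at ha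
      rcases ha with rfl | rfl | rfl | rfl | rfl | rfl
      · simpa using hlt 0 (by norm_num)
      · simpa using hlt 0 (by norm_num)
      · simpa using hlt 3 (by norm_num)
      · simpa using hlt 3 (by norm_num)
      · simpa using hlt 2 (by norm_num)
      · simpa using hlt 4 (by norm_num))
    (fun a ↦ limUnder (𝓝[≠] a) fun w ↦ (w - a) * quotientForm (h ^ 2) w)
    (quotientForm (h ^ 2))
    (fun z hz1 hz2 hz ↦ differentiableAt_quotientForm_of_notMem hh1 hρ0 hρ hz1 hz2 hz)
    (by
      intro a ha
      refine tendsto_nhds_limUnder ?_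
      simp only [Finset.mem_insert, Finset.mem_singleton] at ha
      rcases ha with rfl | rfl | rfl | rfl | rfl | rfl
      exacts [⟨_, h₁⟩, ⟨_, h₂⟩, ⟨_, h₃⟩, ⟨_, h₄⟩, ⟨_, h₅⟩, ⟨_, h₆⟩])
  have hq0 : h ^ 2 ≠ 0 := pow_ne_zero 2 hh
  have hscale := circleIntegral_norm_mul_eq ((h ^ 2) ^ 3) (R := ρ⁻¹) (quotientForm (h ^ 2))
    (fun z hz ↦ quotientForm_mul (norm_pow_lt_one hh1 two_ne_zero) hq0
      (norm_pos_iff.1 (by rw [hz]; positivity)))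
  rw [show ‖(h ^ 2) ^ 3‖ * ρ⁻¹ = ρ ^ 11 by
    rw [norm_pow, norm_pow, ← hρ]
    field_simp] at hscale
  rw [hscale, sub_self] at key
  have key2 := (mul_eq_zero.1 key.symm).resolve_left Complex.two_pi_I_ne_zero
  rw [Finset.sum_insert, Finset.sum_insert, Finset.sum_insert, Finset.sum_insert,
    Finset.sum_insert, Finset.sum_singleton, h₁.limUnder_eq, h₂.limUnder_eq, h₃.limUnder_eq,
    h₄.limUnder_eq, h₅.limUnder_eq, h₆.limUnder_eq] at key2
  · exact key2
  · simpa using hne 2 4 (by norm_num) 1 1 n1 n1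
  · simp only [Finset.mem_insert, Finset.mem_singleton, not_or]
    exact ⟨by simpa using hne 3 2 (by norm_num) (-1) 1 n2 n1,
      by simpa using hne 3 4 (by norm_num) (-1) 1 n2 n1⟩
  · simp only [Finset.mem_insert, Finset.mem_singleton, not_or]
    exact ⟨hself _ (pow_ne_zero 3 hh), by simpa using hne 3 2 (by norm_num) 1 1 n1 n1,
      by simpa using hne 3 4 (by norm_num) 1 1 n1 n1⟩
  · simp only [Finset.mem_insert, Finset.mem_singleton, not_or]
    exact ⟨by simpa using hne 0 3 (by norm_num) (-1) 1 n2 n1,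
      by simpa using hne 0 3 (by norm_num) (-1) (-1) n2 n2,
      by simpa using hne 0 2 (by norm_num) (-1) 1 n2 n1,
      by simpa using hne 0 4 (by norm_num) (-1) 1 n2 n1⟩
  · simp only [Finset.mem_insert, Finset.mem_singleton, not_or]
    exact ⟨hself 1 one_ne_zero, by simpa using hne 0 3 (by norm_num) 1 1 n1 n1,
      by simpa using hne 0 3 (by norm_num) 1 (-1) n1 n2,
      by simpa using hne 0 2 (by norm_num) 1 1 n1 n1,
      by simpa using hne 0 4 (by norm_num) 1 1 n1 n1⟩

/-- The identity between theta constants and eta quotients, in terms of the products. -/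
lemma thetaProd_identity {h : ℂ} (hh : h ≠ 0) (hh1 : ‖h‖ < 1) :
    h ^ 5 * eulerProd (h ^ 42) * thetaProd (-1) (h ^ 42) /
          (eulerProd (h ^ 2) * thetaProd (-1) (h ^ 2))
        - eulerProd (h ^ 42) * thetaProd (-h ^ 21) (h ^ 42) /
          (eulerProd (h ^ 2) * thetaProd (-h) (h ^ 2))
        + eulerProd (h ^ 42) * thetaProd (h ^ 21) (h ^ 42) /
          (eulerProd (h ^ 2) * thetaProd h (h ^ 2)) =
      4 * h * eulerProd (h ^ 6) ^ 3 * eulerProd (h ^ 14) / eulerProd (h ^ 2) ^ 4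
        - 7 * h ^ 5 * (eulerProd (h ^ 42) ^ 3 / eulerProd (h ^ 2) ^ 3) := by
  -- An opaque `q` keeps `simp` and `rw` from merging its powers into powers of `h`.
  obtain ⟨q, hqdef⟩ : ∃ q, q = h ^ 2 := ⟨_, rfl⟩
  rw [← hqdef]
  have hq0 : q ≠ 0 := hqdef ▸ pow_ne_zero 2 hh
  have hq : ‖q‖ < 1 := hqdef ▸ norm_pow_lt_one hh1 two_ne_zero
  have hq3 : ‖q ^ 3‖ < 1 := norm_pow_lt_one hq three_ne_zero
  have hq30 : q ^ 3 ≠ 0 := pow_ne_zero 3 hq0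
  have hq7 : ‖q ^ 7‖ < 1 := norm_pow_lt_one hq (by norm_num)
  have hq21 : ‖q ^ 21‖ < 1 := norm_pow_lt_one hq (by norm_num)
  rw [show h ^ 42 = q ^ 21 by rw [hqdef]; ring, show h ^ 6 = q ^ 3 by rw [hqdef]; ring,
    show h ^ 14 = q ^ 7 by rw [hqdef]; ring]
  have E1 := eulerProd_ne_zero hq
  have E3 := eulerProd_ne_zero hq3
  have E7 := eulerProd_ne_zero hq7
  have E21 := eulerProd_ne_zero hq21
  have Tm : thetaProd (-1) q ≠ 0 := thetaProd_neg_one_ne_zero hq0 hq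
  have Th : thetaProd h q ≠ 0 := by simpa [hqdef] using thetaProd_ne_zero_of_norm_eq hh hh1 norm_one
  have Tnh : thetaProd (-h) q ≠ 0 := by
    simpa [hqdef] using thetaProd_ne_zero_of_norm_eq hh hh1 (u := -1) (by simp)
  have v3 : thetaProd (h ^ 3) q = -h⁻¹ * thetaProd h q := by
    rw [← thetaProd_mul_left hq hq0 hh, hqdef]
    ring_nf
  have v4 : thetaProd (-h ^ 3) q = h⁻¹ * thetaProd (-h) q := by
    have := thetaProd_mul_left hq hq0 (neg_ne_zero.2 hh)
    rw [inv_neg, neg_neg] at this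
    rw [← this, hqdef]
    ring_nf
  have c3 : thetaProd q (q ^ 3) = eulerProd q / eulerProd (q ^ 3) := thetaProd_cube hq hq0
  have c7 : thetaProd (q ^ 7) (q ^ 21) = eulerProd (q ^ 7) / eulerProd (q ^ 21) := by
    have := thetaProd_cube hq7 (pow_ne_zero 7 hq0)
    rwa [← pow_mul] at this
  have c6 : thetaProd (q ^ 2) (q ^ 3) = eulerProd q / eulerProd (q ^ 3) := by
    rw [← c3, ← thetaProd_div q hq30, show q ^ 3 / q = q ^ 2 by field_simp]
  have c14 : thetaProd (q ^ 14) (q ^ 21) = eulerProd (q ^ 7) / eulerProd (q ^ 21) := by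
    rw [← c7, ← thetaProd_div (q ^ 7) (pow_ne_zero 21 hq0),
      show q ^ 21 / q ^ 7 = q ^ 14 by field_simp]
  have c4 : thetaProd (q ^ 4) (q ^ 3) = -q⁻¹ * (eulerProd q / eulerProd (q ^ 3)) := by
    rw [← c3, ← thetaProd_mul_left hq3 hq30 hq0]
    ring_nf
  have hs : (h ^ 3) ^ 2 = q ^ 3 := by rw [hqdef]; ring
  have hs' : (-h ^ 3) ^ 2 = q ^ 3 := by rw [hqdef]; ring
  have hh3 : h ^ 3 ≠ 0 := pow_ne_zero 3 hh
  have d1 : -eulerProd (q ^ 3) ^ 2 ≠ 0 := neg_ne_zero.2 (pow_ne_zero 2 E3)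
  have d3 : eulerProd (q ^ 3) ^ 2 / q ^ 3 ≠ 0 := div_ne_zero (pow_ne_zero 2 E3) hq30
  have key := sum_residues_quotientForm hh hh1 hqdef (tendsto_quotientForm_one hq)
    (tendsto_quotientForm_of_sq (a := -1) hq (by norm_num) Tm
      (by simpa using thetaProd_one hq3) d1 (by simpa using hasDerivAt_thetaProd_one hq3))
    (tendsto_quotientForm_of_sq (a := h ^ 3) hq hh3 (by rw [v3]; simp [hh, Th])
      (by rw [hs]; exact thetaProd_self hq3 hq30) d3
      (by rw [hs]; exact hasDerivAt_thetaProd_self hq3 hq30))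
    (tendsto_quotientForm_of_sq (a := -h ^ 3) hq (neg_ne_zero.2 hh3) (by rw [v4]; simp [hh, Tnh])
      (by rw [hs']; exact thetaProd_self hq3 hq30) d3
      (by rw [hs']; exact hasDerivAt_thetaProd_self hq3 hq30))
    (tendsto_quotientForm_of_zero (a := q) hq hq0 (thetaProd_self hq hq0)
      (by rw [c6]; exact div_ne_zero E1 E3) (div_ne_zero (pow_ne_zero 2 E1) hq0)
      (hasDerivAt_thetaProd_self hq hq0))
    (tendsto_quotientForm_of_zero (a := q ^ 2) hq (pow_ne_zero 2 hq0)
      (by rw [sq, thetaProd_mul_left hq hq0 hq0, thetaProd_self hq hq0, mul_zero])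
      (by
        rw [← pow_mul, c4]
        exact mul_ne_zero (neg_ne_zero.2 (inv_ne_zero hq0)) (div_ne_zero E1 E3))
      (div_ne_zero (neg_ne_zero.2 (pow_ne_zero 2 E1)) hq30) (hasDerivAt_thetaProd_sq hq hq0))
  rw [v3, v4, show (h ^ 3) ^ 7 = h ^ 21 by ring, ← pow_mul q 2 7, c7, c6, c14, ← pow_mul q 2 2, c4,
    show (-1 : ℂ) ^ 7 = -1 by norm_num, show (-h ^ 3) ^ 7 = -h ^ 21 by ring,
    show (-h ^ 3) ^ 3 = -h ^ 9 by ring] at key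
  generalize thetaProd (-1) q = a2, thetaProd (-1) (q ^ 21) = b2,
    thetaProd (-h) q = a3, thetaProd (-h ^ 21) (q ^ 21) = b3, thetaProd h q = a4,
    thetaProd (h ^ 21) (q ^ 21) = b4, eulerProd q = e1, eulerProd (q ^ 3) = e3,
    eulerProd (q ^ 7) = e7, eulerProd (q ^ 21) = e21 at *
  subst hqdef
  -- The identity is the sum of the residues, multiplied by this monomial.
  linear_combination (norm := (field_simp; ring)) (-2 * e3 ^ 2 * e21 * h ^ 5 / e1) * key

end EllipticFunction

/-! ### The identity for theta constants -/

lemma vartheta_ne_zero {τ : ℂ} (hτ : 0 < τ.im) :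
    vartheta2 τ ≠ 0 ∧ vartheta3 τ ≠ 0 ∧ vartheta4 τ ≠ 0 := by
  have hh := halfNome_ne_zero τ
  have hh1 := norm_halfNome_lt_one hτ
  have hq := norm_pow_lt_one hh1 two_ne_zero
  have hE := eulerProd_ne_zero hq
  rw [vartheta2_eq hτ, vartheta3_eq hτ, vartheta4_eq hτ]
  refine ⟨mul_ne_zero (Complex.exp_ne_zero _) (mul_ne_zero hE
    (thetaProd_neg_one_ne_zero (pow_ne_zero 2 hh) hq)), mul_ne_zero hE ?_, mul_ne_zero hE ?_⟩
  · simpa using thetaProd_ne_zero_of_norm_eq hh hh1 (u := -1) (by simp)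
  · simpa using thetaProd_ne_zero_of_norm_eq hh hh1 norm_one

theorem mainTheorem3 (τ : ℂ) (hτ : 0 < τ.im) :
    (vartheta2 τ ≠ 0 ∧ vartheta3 τ ≠ 0 ∧ vartheta4 τ ≠ 0 ∧ ModularForm.eta τ ≠ 0) ∧
      vartheta2 (21 * τ) / vartheta2 τ - vartheta3 (21 * τ) / vartheta3 τ
          + vartheta4 (21 * τ) / vartheta4 τ
        = 4 * ModularForm.eta (3 * τ) ^ 3 * ModularForm.eta (7 * τ) / ModularForm.eta τ ^ 4
          - 7 * (ModularForm.eta (21 * τ) ^ 3 / ModularForm.eta τ ^ 3) := by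
  obtain ⟨n2, n3, n4⟩ := vartheta_ne_zero hτ
  refine ⟨⟨n2, n3, n4, ModularForm.eta_ne_zero hτ⟩, ?_⟩
  have hh := halfNome_ne_zero τ
  have hτ21 : 0 < (21 * τ).im := by simpa using hτ
  have e3 : halfNome (3 * τ) = halfNome τ ^ 3 := by exact_mod_cast halfNome_mul 3 τ
  have e7 : halfNome (7 * τ) = halfNome τ ^ 7 := by exact_mod_cast halfNome_mul 7 τ
  have e21 : halfNome (21 * τ) = halfNome τ ^ 21 := by exact_mod_cast halfNome_mul 21 τ
  have key := thetaProd_identity hh (norm_halfNome_lt_one hτ)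
  -- All fractional powers of the nome are powers of `t`, its power of exponent `1 / 24`.
  set t := nomePow τ (1 / 24) with ht
  have ht0 : t ≠ 0 := Complex.exp_ne_zero _
  have hpow : ∀ (c r : ℂ) (n : ℕ), (24 * c * r = n) → ∀ s : ℝ, (s : ℂ) = r →
      nomePow (c * τ) s = t ^ n := by
    intro c r n hn s hs
    rw [ht, nomePow, nomePow, ← Complex.exp_nat_mul, hs, ← hn]
    push_cast
    ring_nf
  have p8 : nomePow τ (1 / 8) = t ^ 3 := by
    simpa using hpow 1 (1 / 8) 3 (by norm_num) (1 / 8) (by norm_num)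
  have q8 := hpow 21 (1 / 8) 63 (by norm_num) (1 / 8) (by norm_num)
  have q3 := hpow 3 (1 / 24) 3 (by norm_num) (1 / 24) (by norm_num)
  have q7 := hpow 7 (1 / 24) 7 (by norm_num) (1 / 24) (by norm_num)
  have q21 := hpow 21 (1 / 24) 21 (by norm_num) (1 / 24) (by norm_num)
  have hht : halfNome τ = t ^ 12 := by
    rw [← hpow 1 (1 / 2) 12 (by norm_num) (1 / 2) (by norm_num), one_mul,
      nomePow_eq_halfNome_pow τ (n := 1) (by norm_num), pow_one]
  rw [vartheta2_eq hτ, vartheta3_eq hτ, vartheta4_eq hτ, vartheta2_eq hτ21, vartheta3_eq hτ21,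
    vartheta4_eq hτ21, eta_eq, eta_eq, eta_eq, eta_eq, e3, e7, e21, ← ht, p8, q8, q3, q7, q21]
  simp only [← pow_mul, Nat.reduceMul]
  have hE := eulerProd_ne_zero (norm_pow_lt_one (norm_halfNome_lt_one hτ) two_ne_zero)
  calc _ = _ := ?_
    _ = _ := key
    _ = _ := ?_
  · have hc : ∀ a b : ℂ, t ^ 63 * a / (t ^ 3 * b) = halfNome τ ^ 5 * a / b := fun a b ↦ by
      rw [hht, show t ^ 63 * a = t ^ 3 * ((t ^ 12) ^ 5 * a) by ring,
        mul_div_mul_left _ _ (pow_ne_zero 3 ht0)]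
    rw [hc, mul_assoc (halfNome τ ^ 5)]
  · generalize eulerProd (halfNome τ ^ 6) = x3, eulerProd (halfNome τ ^ 14) = x7,
      eulerProd (halfNome τ ^ 42) = x21, eulerProd (halfNome τ ^ 2) = x1 at *
    rw [hht]
    field_simp
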